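/- Let $q$ be a prime power and let $n\ge 1$. A $q$-ary quantum code of length $n$ is a subspace $Q$ of the Hilbert space $(\mathbb{C}^q)^{\otimes n}$. Let $P$ be the orthogonal projection onto $Q$. The code $Q$ detects a linear operator $E$ on $(\mathbb{C}^q)^{\otimes n}$ if $PEP=cP$ for some $c\in\mathbb{C}$, where, in case $\dim_{\mathbb{C}} Q=1$, one requires in addition that $c=\operatorname{tr}(E)/q^n$. The minimum distance of $Q$ is the largest integer $d$ such that $Q$ detects every operator that acts as the identity on all but at most $d-1$ of the $n$ tensor factors. A $q$-ary $[[n,k,d]]$ quantum code is such a $Q$ with $\dim_{\mathbb{C}} Q=q^k$ and minimum distance $d$; it is called a quantum MDS code if it attains the quantum Singleton bound, that is, if $k=n-2d+2$. Theorem. Let $q$ be a prime power and let $1\le t\le q$. Then for every integer $d$ with $2\le d\le \left\lfloor\frac{tq+q-1}{q+1}\right\rfloor+1$ there exists a $q$-ary $[[tq,\,tq-2d+2,\,d]]$ quantum MDS code. -/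

import Mathlib

/-- The Hilbert space `(ℂ^q)^{⊗ n}`, in coordinates with respect to the orthonormal basis
`|x₁⟩ ⊗ ⋯ ⊗ |xₙ⟩`, where `x` ranges over the words of length `n` over an alphabet of size `q`. -/
abbrev QuditSpace (q n : ℕ) : Type := EuclideanSpace ℂ (Fin n → Fin q)

/-- Matrices of the linear operators on `(ℂ^q)^{⊗ n}`. -/
abbrev QuditOp (q n : ℕ) : Type := Matrix (Fin n → Fin q) (Fin n → Fin q) ℂ

/-- The operator `E` acts only on the tensor factors in `S`: it is `A ⊗ I` for an operator `A` on
the factors in `S` and the identity `I` on the factors outside `S`. -/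
def QuditOp.SupportedOn {q n : ℕ} (E : QuditOp q n) (S : Finset (Fin n)) : Prop :=
  ∃ A : Matrix (S → Fin q) (S → Fin q) ℂ, ∀ x y : Fin n → Fin q,
    E x y = if ∀ i, i ∉ S → x i = y i then A (fun i => x i) (fun i => y i) else 0

/-- The Knill-Laflamme condition with constant `c`: `P E P = c P`, where `P` is the orthogonal
projection onto the code `Q`. -/
def KnillLaflamme {q n : ℕ} (Q : Submodule ℂ (QuditSpace q n)) (E : QuditOp q n) (c : ℂ) : Prop :=
  ∀ u ∈ Q, ∀ v ∈ Q, inner ℂ u (Matrix.toEuclideanLin E v) = c * inner ℂ u v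

/-- The code `Q` detects the error `E`. A code of dimension at least two does so if `P E P = c P`
for some scalar `c`. That is vacuous for a one-dimensional code, which is asked, as usual, to be
pure: `c` has to be the normalized trace of `E`
(so `0` for every traceless `E`, for instance for every nontrivial tensor product of Pauli errors).
-/
def DetectsError {q n : ℕ} (Q : Submodule ℂ (QuditSpace q n)) (E : QuditOp q n) : Prop :=
  ∃ c : ℂ, KnillLaflamme Q E c ∧ (Module.finrank ℂ Q = 1 → c = E.trace / (q : ℂ) ^ n)

/-- `Q` detects every error that affects fewer than `d` of the `n` tensor factors. -/
def DetectsBelow {q n : ℕ} (Q : Submodule ℂ (QuditSpace q n)) (d : ℕ) : Prop :=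
  ∀ S : Finset (Fin n), S.card < d → ∀ E : QuditOp q n, E.SupportedOn S → DetectsError Q E

/-- `d` is the minimum distance of `Q`: the largest `d` such that `Q` detects all errors
on at most `d - 1` tensor factors. -/
def HasMinDist {q n : ℕ} (Q : Submodule ℂ (QuditSpace q n)) (d : ℕ) : Prop :=
  IsGreatest {e : ℕ | DetectsBelow Q e} d

/-- `Q` is a `q`-ary `[[n, k, d]]` quantum code: a subspace of `(ℂ^q)^{⊗ n}` of dimension `q ^ k`
and minimum distance `d`. -/
def IsQuantumCode {q n : ℕ} (Q : Submodule ℂ (QuditSpace q n)) (k d : ℕ) : Prop :=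
  Module.finrank ℂ Q = q ^ k ∧ HasMinDist Q d

/-- `Q` is a `q`-ary `[[n, k, d]]` quantum MDS code: it attains the quantum Singleton bound
`k ≤ n - 2 d + 2`. -/
def IsQuantumMDSCode {q n : ℕ} (Q : Submodule ℂ (QuditSpace q n)) (k d : ℕ) : Prop :=
  IsQuantumCode Q k d ∧ (k : ℤ) = (n : ℤ) - 2 * (d : ℤ) + 2

/-!
The codes are stabilizer codes of generalized Reed-Solomon codes over `L = 𝔽_{q²}`.

Put `k = d - 1` and `n = tq`, and let `γ ∈ L` lie outside `K = 𝔽_q`. The evaluation points are the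
elements `b + γ δⱼ` of `t` parallel cosets of `K`. Since `∏ (z - b) = z ^ q - z` over `b ∈ K`, the
product of the differences of a point to all others lies in `θ ^ (t - 1) K`, where `θ = γ ^ q - γ`
(`exists_prod_erase_cosets`). The norm `L → K` is surjective, so there are multipliers `vᵢ` whose
norms `vᵢ ^ (q + 1)` are the Lagrange weights of the points up to a common factor. The code of the
words `(vᵢ f(xᵢ))` with `deg f < k` is then Hermitian self-orthogonal
(`grsEncode_hermitian_eq_zero`): the Hermitian product of the words of `f` and `g` is the divided
difference of `f g ^ q`, a polynomial of degree at most `(k - 1)(q + 1) ≤ n - 2`. This last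
inequality is the upper bound on `d`.

In coordinates for the basis `1, γ` of `L` over `K`, code words index Weyl operators on
`(ℂ^q)^{⊗ n}`, and self-orthogonality makes these commute (`dotProduct_eq_of_hermitian_eq_zero`). The
quantum code is a common eigenspace. Its dimension is the trace of the projection onto it, namely
`q ^ n / (q ^ 2) ^ k` (`finrank_stabilizerCode_mul_card`).

The distance is at least `k + 1` because any `k` positions are an information set of the
Reed-Solomon code: the stabilizer restricts onto all Weyl operators on these positions, and
averaging an operator `E` on these positions over conjugation by all of them gives `tr(E) / q ^ n`
(`inner_toEuclideanLin_of_mem_stabilizerCode`). This is the strict condition required of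
one-dimensional codes, too. The distance is at most `k + 1` because the Hermitian dual has a word
of weight `k + 1`, whose Weyl operator commutes with the stabilizer and is not detected
(`not_exists_inner_weyl_eq`): if `n > 2k`, the Reed-Solomon code has minimum distance
`n - k + 1 > k + 1`, so the operator lies outside the stabilizer; if `n = 2k`, the quantum code is
one-dimensional, and a traceless error acting on it as a nonzero scalar is not detected.
-/

/-! ### Weyl operators -/

section Weyl

open Matrix Finset

variable {ι K : Type*} [Fintype ι] [Field K] [DecidableEq K]

/-- The Weyl (generalized Pauli) operator `|y⟩ ↦ ψ(b · (y + a)) |y + a⟩` on `(ℂ^K)^{⊗ ι}`: the shift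
by `a`, followed by the phase `ψ(b · x)`. -/
def weyl (ψ : AddChar K ℂ) (a b : ι → K) : Matrix (ι → K) (ι → K) ℂ :=
  Matrix.of fun x y => if x = y + a then ψ (b ⬝ᵥ x) else 0

variable (ψ : AddChar K ℂ)

theorem weyl_apply (a b x y : ι → K) :
    weyl ψ a b x y = if x = y + a then ψ (b ⬝ᵥ x) else 0 := rfl

theorem weyl_zero : weyl ψ (0 : ι → K) 0 = 1 := by
  ext x y
  simp [weyl_apply, Matrix.one_apply]

variable [DecidableEq ι] [Fintype K]

theorem weyl_mul (a b a' b' : ι → K) :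
    weyl ψ a b * weyl ψ a' b' = ψ (-(b' ⬝ᵥ a)) • weyl ψ (a + a') (b + b') := by
  ext x z
  rw [Matrix.mul_apply, Finset.sum_eq_single (z + a')]
  · rw [Matrix.smul_apply, weyl_apply, weyl_apply, weyl_apply, if_pos rfl]
    have h : x = z + a' + a ↔ x = z + (a + a') := by rw [add_assoc, add_comm a']
    by_cases hx : x = z + a' + a
    · rw [if_pos hx, if_pos (h.1 hx), smul_eq_mul, ← AddChar.map_add_eq_mul,
        ← AddChar.map_add_eq_mul, hx]
      congr 1
      simp only [dotProduct_add, add_dotProduct]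
      ring
    · rw [if_neg hx, if_neg (h.not.1 hx), zero_mul, smul_zero]
  · intro y _ hy
    rw [weyl_apply ψ a', if_neg hy, mul_zero]
  · simp

theorem weyl_commute {a b a' b' : ι → K} (h : b ⬝ᵥ a' = b' ⬝ᵥ a) :
    weyl ψ a b * weyl ψ a' b' = weyl ψ a' b' * weyl ψ a b := by
  rw [weyl_mul, weyl_mul, h, add_comm a, add_comm b]

theorem conjTranspose_weyl_mul_mul_weyl (a b : ι → K) (E : Matrix (ι → K) (ι → K) ℂ)
    (x y : ι → K) :
    ((weyl ψ a b)ᴴ * E * weyl ψ a b) x y = ψ (b ⬝ᵥ (y - x)) * E (x + a) (y + a) := by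
  rw [Matrix.mul_apply, Finset.sum_eq_single (y + a)]
  · rw [Matrix.mul_apply, Finset.sum_eq_single (x + a)]
    · rw [Matrix.conjTranspose_apply, weyl_apply, weyl_apply, if_pos rfl, if_pos rfl,
        RCLike.star_def, ← AddChar.map_neg_eq_conj, mul_right_comm, ← AddChar.map_add_eq_mul]
      congr 2
      simp only [dotProduct_add, dotProduct_sub]
      ring
    · intro z _ hz
      rw [Matrix.conjTranspose_apply, weyl_apply, if_neg hz, star_zero, zero_mul]
    · simp
  · intro z _ hz
    rw [weyl_apply, if_neg hz, mul_zero]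
  · simp

theorem conjTranspose_weyl_mul_self (a b : ι → K) : (weyl ψ a b)ᴴ * weyl ψ a b = 1 := by
  ext x y
  have h := conjTranspose_weyl_mul_mul_weyl ψ a b 1 x y
  rw [Matrix.mul_one] at h
  rw [h]
  by_cases hxy : x = y
  · rw [hxy, Matrix.one_apply_eq, Matrix.one_apply_eq, sub_self, dotProduct_zero,
      AddChar.map_zero_eq_one, one_mul]
  · rw [Matrix.one_apply_ne hxy, Matrix.one_apply_ne (by simpa using hxy), mul_zero]

theorem weyl_mul_conjTranspose (a b : ι → K) : weyl ψ a b * (weyl ψ a b)ᴴ = 1 :=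
  mul_eq_one_comm.1 (conjTranspose_weyl_mul_self ψ a b)

theorem trace_weyl (hψ : ψ ≠ 0) {a b : ι → K} (h : a ≠ 0 ∨ b ≠ 0) :
    (weyl ψ a b).trace = 0 := by
  rw [Matrix.trace]
  by_cases ha : a = 0
  · have hb : b ≠ 0 := h.resolve_left (not_not.2 ha)
    obtain ⟨i, hi⟩ := Function.ne_iff.1 hb
    obtain ⟨s, hs⟩ := AddChar.ne_zero_iff.1 hψ
    let φ : AddChar (ι → K) ℂ := ψ.compAddMonoidHom
      { toFun := fun x => b ⬝ᵥ x, map_zero' := by simp, map_add' := by simp [dotProduct_add] }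
    have hφ : φ ≠ 0 := by
      refine AddChar.ne_zero_iff.2 ⟨Pi.single i ((b i)⁻¹ * s), ?_⟩
      simpa [φ, mul_inv_cancel_left₀ (show b i ≠ 0 from hi)] using hs
    rw [← AddChar.sum_eq_zero_iff_ne_zero.2 hφ]
    refine Finset.sum_congr rfl fun x _ => ?_
    simp [weyl_apply, ha, φ]
  · refine Finset.sum_eq_zero fun x _ => ?_
    rw [Matrix.diag_apply, weyl_apply, if_neg]
    simpa using ha

end Weyl

/-! ### Common eigenvectors of commuting operators -/

section Eigen

open Finset

/-- Eigenvectors common to the operators with index in a finite set `s` form a subspace invariant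
under the remaining operators, so operators can be added to `s` one at a time. -/
theorem exists_common_eigenvector {G V : Type*} [Fintype G] [AddCommGroup V] [Module ℂ V]
    [FiniteDimensional ℂ V] [Nontrivial V] (T : G → Module.End ℂ V)
    (hT : ∀ g h, T g * T h = T h * T g) :
    ∃ (v : V) (c : G → ℂ), v ≠ 0 ∧ ∀ g, T g v = c g • v := by
  classical
  suffices H : ∀ s : Finset G, ∃ c : G → ℂ, (⨅ g ∈ s, (T g).eigenspace (c g)) ≠ ⊥ by
    obtain ⟨c, hc⟩ := H univ
    obtain ⟨v, hv, hv0⟩ := Submodule.exists_mem_ne_zero_of_ne_bot hc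
    refine ⟨v, c, hv0, fun g => ?_⟩
    simp only [Submodule.mem_iInf] at hv
    exact Module.End.mem_eigenspace_iff.1 (hv g (mem_univ g))
  intro s
  induction s using Finset.induction_on with
  | empty => exact ⟨0, by simp⟩
  | insert h s hs ih =>
    obtain ⟨c, hc⟩ := ih
    set W := ⨅ g ∈ s, (T g).eigenspace (c g) with hW
    have hmaps : ∀ v ∈ W, T h v ∈ W := by
      intro v hv
      simp only [hW, Submodule.mem_iInf, Module.End.mem_eigenspace_iff] at hv ⊢
      intro g hg
      rw [← Module.End.mul_apply, hT, Module.End.mul_apply, hv g hg, map_smul]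
    have : Nontrivial W := Submodule.nontrivial_iff_ne_bot.2 hc
    obtain ⟨μ, hμ⟩ := Module.End.exists_eigenvalue ((T h).restrict hmaps)
    obtain ⟨w, hw⟩ := hμ.exists_hasEigenvector
    refine ⟨Function.update c h μ, Submodule.ne_bot_iff _ |>.2 ⟨w, ?_, ?_⟩⟩
    · have hw2 := w.2
      simp only [hW, Submodule.mem_iInf, Module.End.mem_eigenspace_iff] at hw2
      simp only [Submodule.mem_iInf, Module.End.mem_eigenspace_iff]
      intro g hg
      rcases Finset.mem_insert.1 hg with rfl | hgs
      · have := congrArg Subtype.val hw.apply_eq_smul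
        simpa using this
      · rw [Function.update_of_ne (by rintro rfl; exact hs hgs)]
        exact hw2 g hgs
    · simpa using hw.2

end Eigen

/-! ### Stabilizer codes -/

section Stabilizer

open Matrix Finset

variable {ι K G : Type*} [Fintype ι] [Field K] [AddCommGroup G]

/-- The scalars `c g` have absolute value one and multiply with the same cocycle as the Weyl
operators `W g = weyl ψ (a g) (b g)`. Hence the operators `(c g)⁻¹ W g` form a unitary
representation of `G`, and the code is the space of its invariants. -/
structure IsPhase (ψ : AddChar K ℂ) (a b : G →+ (ι → K)) (c : G → ℂ) : Prop where
  star_mul_self : ∀ g, star (c g) * c g = 1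
  mul : ∀ g h, c g * c h = ψ (-(b h ⬝ᵥ a g)) * c (g + h)

variable {ψ : AddChar K ℂ} {a b : G →+ (ι → K)} {c : G → ℂ}

theorem IsPhase.ne_zero (hc : IsPhase ψ a b c) (g : G) : c g ≠ 0 :=
  right_ne_zero_of_mul_eq_one (hc.star_mul_self g)

theorem IsPhase.zero (hc : IsPhase ψ a b c) : c 0 = 1 := by
  have h := hc.mul 0 0
  simp only [map_zero, zero_dotProduct, neg_zero, AddChar.map_zero_eq_one, add_zero] at h
  exact mul_right_cancel₀ (hc.ne_zero 0) h

variable [DecidableEq ι] [Fintype K] [DecidableEq K]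

theorem inner_toEuclideanLin_weyl (ψ : AddChar K ℂ) (a b : ι → K)
    (E : Matrix (ι → K) (ι → K) ℂ) (u v : EuclideanSpace ℂ (ι → K)) :
    inner ℂ (toEuclideanLin (weyl ψ a b) u) (toEuclideanLin E (toEuclideanLin (weyl ψ a b) v)) =
      inner ℂ u (toEuclideanLin ((weyl ψ a b)ᴴ * E * weyl ψ a b) v) := by
  rw [← LinearMap.adjoint_inner_right, ← Matrix.toEuclideanLin_conjTranspose_eq_adjoint,
    Matrix.toLpLin_mul_same, Matrix.toLpLin_mul_same]
  rfl

/-- The common eigenspace of the Weyl operators indexed by `G`, with eigenvalues `c`. -/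
noncomputable def stabilizerCode (ψ : AddChar K ℂ) (a b : G →+ (ι → K)) (c : G → ℂ) :
    Submodule ℂ (EuclideanSpace ℂ (ι → K)) :=
  ⨅ g, Module.End.eigenspace (toEuclideanLin (weyl ψ (a g) (b g))) (c g)

theorem mem_stabilizerCode {v : EuclideanSpace ℂ (ι → K)} :
    v ∈ stabilizerCode ψ a b c ↔ ∀ g, toEuclideanLin (weyl ψ (a g) (b g)) v = c g • v := by
  simp [stabilizerCode, Submodule.mem_iInf]

/-- The eigenvalues of a common eigenvector serve as phases. This works in every characteristic, in
particular in characteristic two, where no formula such as `ψ (a g ⬝ᵥ b g / 2)` is available. -/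
theorem exists_isPhase [Finite G] (hcomm : ∀ g h, b g ⬝ᵥ a h = b h ⬝ᵥ a g) :
    ∃ c, IsPhase ψ a b c := by
  have := Fintype.ofFinite G
  obtain ⟨v, c, hv, hc⟩ := exists_common_eigenvector
    (fun g => toEuclideanLin (weyl ψ (a g) (b g))) (by
      intro g h
      rw [Module.End.mul_eq_comp, Module.End.mul_eq_comp, ← Matrix.toLpLin_mul_same,
        ← Matrix.toLpLin_mul_same, weyl_commute ψ (hcomm g h)])
  refine ⟨c, fun g => ?_, fun g h => ?_⟩
  · have h := inner_toEuclideanLin_weyl ψ (a g) (b g) 1 v v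
    rw [Matrix.mul_one, conjTranspose_weyl_mul_self, hc] at h
    simp only [Matrix.toLpLin_one, LinearMap.id_apply, inner_smul_left, inner_smul_right] at h
    rw [← mul_assoc, mul_comm (c g)] at h
    exact mul_right_cancel₀ (inner_self_ne_zero.2 hv) (h.trans (one_mul _).symm)
  · have h1 : toEuclideanLin (weyl ψ (a g) (b g) * weyl ψ (a h) (b h)) v = (c g * c h) • v := by
      rw [Matrix.toLpLin_mul_same, LinearMap.comp_apply, hc, map_smul, hc, smul_smul, mul_comm]
    rw [weyl_mul, ← map_add, ← map_add, map_smul, LinearMap.smul_apply, hc, smul_smul] at h1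
    exact (smul_left_injective ℂ hv h1).symm

/-- The projection onto the stabilizer code, as the average of the operators `(c g)⁻¹ W g`. -/
noncomputable def stabilizerProj [Fintype G] (ψ : AddChar K ℂ) (a b : G →+ (ι → K))
    (c : G → ℂ) : Matrix (ι → K) (ι → K) ℂ :=
  (Fintype.card G : ℂ)⁻¹ • ∑ g, (c g)⁻¹ • weyl ψ (a g) (b g)

theorem weyl_mul_stabilizerProj [Fintype G] (hc : IsPhase ψ a b c) (h : G) :
    weyl ψ (a h) (b h) * stabilizerProj ψ a b c = c h • stabilizerProj ψ a b c := by
  rw [stabilizerProj, Matrix.mul_smul, smul_comm (c h), Finset.mul_sum]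
  congr 1
  rw [← Equiv.sum_comp (Equiv.addLeft h) fun g => (c g)⁻¹ • weyl ψ (a g) (b g), Finset.smul_sum]
  refine Finset.sum_congr rfl fun g _ => ?_
  rw [Matrix.mul_smul, weyl_mul, smul_smul, smul_smul, Equiv.coe_addLeft, map_add, map_add]
  congr 1
  have h1 := hc.ne_zero g
  have h2 := hc.ne_zero (h + g)
  field_simp
  rw [mul_comm (c g), hc.mul h g, mul_comm]

theorem isProj_stabilizerProj [Fintype G] (hc : IsPhase ψ a b c) :
    LinearMap.IsProj (stabilizerCode ψ a b c) (toEuclideanLin (stabilizerProj ψ a b c)) := by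
  refine ⟨fun v => mem_stabilizerCode.2 fun h => ?_, fun v hv => ?_⟩
  · rw [← LinearMap.comp_apply, ← Matrix.toLpLin_mul_same, weyl_mul_stabilizerProj hc, map_smul,
      LinearMap.smul_apply]
  · rw [mem_stabilizerCode] at hv
    simp only [stabilizerProj, map_smul, map_sum, LinearMap.smul_apply, LinearMap.sum_apply, hv,
      smul_smul, inv_mul_cancel₀ (hc.ne_zero _), one_smul, Finset.sum_const, Finset.card_univ]
    rw [← Nat.cast_smul_eq_nsmul ℂ, smul_smul, inv_mul_cancel₀, one_smul]
    exact Nat.cast_ne_zero.2 Fintype.card_ne_zero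

theorem trace_toEuclideanLin {m : Type*} [Fintype m] [DecidableEq m] (A : Matrix m m ℂ) :
    LinearMap.trace ℂ _ (toEuclideanLin A) = A.trace := by
  rw [Matrix.toEuclideanLin_eq_toLin_orthonormal, Matrix.trace_toLin_eq]

/-- The dimension is the trace of the projection, and only the identity among the Weyl operators has
nonzero trace. -/
theorem finrank_stabilizerCode_mul_card [Fintype G] (hψ : ψ ≠ 0)
    (hinj : ∀ g, a g = 0 → b g = 0 → g = 0) (hc : IsPhase ψ a b c) :
    Module.finrank ℂ (stabilizerCode ψ a b c) * Fintype.card G =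
      Fintype.card K ^ Fintype.card ι := by
  have h := (isProj_stabilizerProj hc).trace
  rw [trace_toEuclideanLin, stabilizerProj, Matrix.trace_smul, Matrix.trace_sum,
    Finset.sum_eq_single 0, hc.zero, map_zero, map_zero, weyl_zero, inv_one, one_smul,
    Matrix.trace_one, smul_eq_mul, inv_mul_eq_iff_eq_mul₀] at h
  · rw [mul_comm, ← @Nat.cast_inj ℂ, Nat.cast_mul, ← h, Fintype.card_fun]
  · exact Nat.cast_ne_zero.2 Fintype.card_ne_zero
  · intro g _ hg
    rw [Matrix.trace_smul, trace_weyl ψ hψ, smul_zero]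
    by_contra! hab
    exact hg (hinj g hab.1 hab.2)
  · simp

end Stabilizer

/-! ### Error detection by stabilizer codes -/

section Detection

open Matrix Finset

/-- The operator `E` on `(ℂ^K)^{⊗ ι}` acts only on the tensor factors in `S`: it is `A ⊗ I`.
Unlike in `QuditOp.SupportedOn`, no decidability instance enters. -/
def ActsOn {ι K : Type*} (S : Finset ι) (E : Matrix (ι → K) (ι → K) ℂ) : Prop :=
  ∃ A : Matrix (S → K) (S → K) ℂ, ∀ x y : ι → K,
    ((∀ i, i ∉ S → x i = y i) → E x y = A (fun i => x i) (fun i => y i)) ∧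
      ((∃ i, i ∉ S ∧ x i ≠ y i) → E x y = 0)

theorem QuditOp.supportedOn_iff_actsOn {q n : ℕ} {E : QuditOp q n} {S : Finset (Fin n)} :
    E.SupportedOn S ↔ ActsOn S E := by
  refine exists_congr fun A => forall₂_congr fun x y => ⟨fun h => ⟨fun hxy => ?_, ?_⟩, fun h => ?_⟩
  · rw [h, if_pos hxy]
  · rintro ⟨i, hi, hne⟩
    rw [h, if_neg fun hxy => hne (hxy i hi)]
  · split_ifs with hxy
    · exact h.1 hxy
    · push Not at hxy
      exact h.2 hxy

variable {ι K G : Type*} [Fintype ι] [DecidableEq ι] [Field K] [DecidableEq K]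
  [AddCommGroup G] {ψ : AddChar K ℂ} {a b : G →+ (ι → K)} {c : G → ℂ}

theorem weyl_actsOn {S : Finset ι} {a₀ b₀ : ι → K} (ha : ∀ i, i ∉ S → a₀ i = 0)
    (hb : ∀ i, i ∉ S → b₀ i = 0) : ActsOn S (weyl ψ a₀ b₀) := by
  refine ⟨weyl ψ (fun i : S => a₀ i) (fun i : S => b₀ i), fun x y => ⟨fun h => ?_, ?_⟩⟩
  · have hdot : (fun i : S => b₀ i) ⬝ᵥ (fun i : S => x i) = b₀ ⬝ᵥ x := by
      rw [dotProduct, dotProduct, Finset.sum_coe_sort S fun i => b₀ i * x i]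
      refine Finset.sum_subset (Finset.subset_univ S) fun i _ hi => ?_
      rw [hb i hi, zero_mul]
    rw [weyl_apply, weyl_apply, hdot]
    refine if_congr ?_ rfl rfl
    simp only [funext_iff, Pi.add_apply, Subtype.forall]
    refine ⟨fun hx i _ => hx i, fun hx i => ?_⟩
    by_cases hi : i ∈ S
    · exact hx i hi
    · rw [h i hi, ha i hi, add_zero]
  · rintro ⟨i, hi, hne⟩
    refine if_neg fun hx => hne ?_
    rw [hx, Pi.add_apply, ha i hi, add_zero]

variable [Fintype K]

theorem weyl_mem_stabilizerCode {a₀ b₀ : ι → K} (hcomm : ∀ g, b g ⬝ᵥ a₀ = b₀ ⬝ᵥ a g)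
    {v : EuclideanSpace ℂ (ι → K)} (hv : v ∈ stabilizerCode ψ a b c) :
    toEuclideanLin (weyl ψ a₀ b₀) v ∈ stabilizerCode ψ a b c := by
  refine mem_stabilizerCode.2 fun g => ?_
  rw [← LinearMap.comp_apply, ← Matrix.toLpLin_mul_same, weyl_commute ψ (hcomm g),
    Matrix.toLpLin_mul_same, LinearMap.comp_apply, mem_stabilizerCode.1 hv, map_smul]

variable [Fintype G]

/-- If the stabilizer restricts onto all Weyl operators on the factors in `S`, averaging an operator
acting on `S` over conjugation by the stabilizer turns it into a scalar. -/
theorem exists_sum_conj_weyl_eq_smul_one (hψ : ψ ≠ 0) {S : Finset ι}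
    (hS : ∀ α β : ι → K, ∃ g, ∀ i ∈ S, a g i = α i ∧ b g i = β i)
    {E : Matrix (ι → K) (ι → K) ℂ} (hE : ActsOn S E) :
    ∃ κ : ℂ, ∑ g, (weyl ψ (a g) (b g))ᴴ * E * weyl ψ (a g) (b g) = κ • 1 := by
  obtain ⟨A, hE⟩ := hE
  refine ⟨∑ g, E (a g) (a g), ?_⟩
  ext x y
  rw [Matrix.sum_apply, Matrix.smul_apply]
  simp only [conjTranspose_weyl_mul_mul_weyl]
  by_cases hxy : x = y
  · subst hxy
    -- translating the summation index by `g₀` moves the diagonal entry at `0` to the one at `x`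
    obtain ⟨g₀, hg₀⟩ := hS x 0
    rw [Matrix.one_apply_eq, smul_eq_mul, mul_one,
      ← Equiv.sum_comp (Equiv.addLeft g₀) fun g => E (a g) (a g)]
    refine Finset.sum_congr rfl fun g _ => ?_
    rw [sub_self, dotProduct_zero, AddChar.map_zero_eq_one, one_mul, (hE _ _).1 (by simp),
      (hE _ _).1 (by simp)]
    congr <;>
    · funext i
      simp [(hg₀ i i.2).1]
  · rw [Matrix.one_apply_ne hxy, smul_zero]
    by_cases hoff : ∀ i, i ∉ S → x i = y i
    · obtain ⟨i, hi⟩ := Function.ne_iff.1 hxy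
      have hiS : i ∈ S := by
        by_contra h
        exact hi (hoff i h)
      obtain ⟨s, hs⟩ := AddChar.ne_zero_iff.1 hψ
      obtain ⟨g₀, hg₀⟩ := hS 0 (Pi.single i (s * (y i - x i)⁻¹))
      have hdot : b g₀ ⬝ᵥ (y - x) = s := by
        rw [dotProduct, Finset.sum_eq_single i]
        · rw [(hg₀ i hiS).2, Pi.single_eq_same, Pi.sub_apply,
            inv_mul_cancel_right₀ (sub_ne_zero.2 (Ne.symm hi))]
        · intro j _ hji
          by_cases hj : j ∈ S
          · rw [(hg₀ j hj).2, Pi.single_eq_of_ne hji, zero_mul]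
          · rw [Pi.sub_apply, hoff j hj, sub_self, mul_zero]
        · simp
      -- translating the summation index by `g₀` multiplies the sum by `ψ s ≠ 1`
      refine (mul_left_eq_self₀.1 (?_ : ψ s * _ = _)).resolve_left hs
      rw [Finset.mul_sum]
      refine Eq.symm (Eq.trans (Equiv.sum_comp (Equiv.addLeft g₀) _).symm ?_)
      refine Finset.sum_congr rfl fun g _ => ?_
      rw [Equiv.coe_addLeft, map_add, map_add, add_dotProduct, hdot, AddChar.map_add_eq_mul,
        mul_assoc, (hE _ _).1 (by simpa using hoff), (hE (x + a g) _).1 (by simpa using hoff)]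
      congr <;>
      · funext i
        simp [(hg₀ i i.2).1]
    · refine Finset.sum_eq_zero fun g _ => ?_
      rw [(hE _ _).2 (by simpa using hoff), mul_zero]

/-- On the code, every stabilizer operator is a unimodular scalar, so that conjugating `E` by it
does not change the matrix elements of `E`. They therefore agree with those of the average, a
scalar whose value the trace determines. -/
theorem inner_toEuclideanLin_of_mem_stabilizerCode (hψ : ψ ≠ 0) (hc : IsPhase ψ a b c)
    {S : Finset ι} (hS : ∀ α β : ι → K, ∃ g, ∀ i ∈ S, a g i = α i ∧ b g i = β i)
    {E : Matrix (ι → K) (ι → K) ℂ} (hE : ActsOn S E)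
    {u v : EuclideanSpace ℂ (ι → K)} (hu : u ∈ stabilizerCode ψ a b c)
    (hv : v ∈ stabilizerCode ψ a b c) :
    inner ℂ u (toEuclideanLin E v) =
      E.trace / (Fintype.card K : ℂ) ^ Fintype.card ι * inner ℂ u v := by
  obtain ⟨κ, hκ⟩ := exists_sum_conj_weyl_eq_smul_one (a := a) (b := b) hψ hS hE
  have hG : (Fintype.card G : ℂ) ≠ 0 := Nat.cast_ne_zero.2 Fintype.card_ne_zero
  have hK : (Fintype.card K : ℂ) ^ Fintype.card ι ≠ 0 :=
    pow_ne_zero _ (Nat.cast_ne_zero.2 Fintype.card_ne_zero)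
  have htr : (Fintype.card G : ℂ) * E.trace = κ * (Fintype.card K : ℂ) ^ Fintype.card ι := by
    have h := congrArg Matrix.trace hκ
    rw [Matrix.trace_sum, Matrix.trace_smul, Matrix.trace_one, Fintype.card_fun, smul_eq_mul,
      Nat.cast_pow] at h
    rw [← h]
    simp only [Matrix.trace_mul_comm _ (weyl ψ _ _), ← Matrix.mul_assoc, weyl_mul_conjTranspose,
      Matrix.one_mul, Finset.sum_const, Finset.card_univ, nsmul_eq_mul]
  have hin : (Fintype.card G : ℂ) * inner ℂ u (toEuclideanLin E v) = κ * inner ℂ u v := by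
    have h := congrArg (fun M => inner ℂ u (toEuclideanLin M v)) hκ
    simp only [map_sum, LinearMap.sum_apply, inner_sum, map_smul, LinearMap.smul_apply,
      inner_smul_right, Matrix.toLpLin_one, LinearMap.id_apply] at h
    rw [← h, ← nsmul_eq_mul, ← Finset.card_univ, ← Finset.sum_const]
    refine Finset.sum_congr rfl fun g _ => ?_
    rw [← inner_toEuclideanLin_weyl, mem_stabilizerCode.1 hu, mem_stabilizerCode.1 hv, map_smul,
      inner_smul_left, inner_smul_right, ← mul_assoc]
    have := hc.star_mul_self g
    rw [RCLike.star_def] at this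
    rw [this, one_mul]
  field_simp
  apply mul_left_cancel₀ hG
  linear_combination (Fintype.card K : ℂ) ^ Fintype.card ι * hin - inner ℂ u v * htr

/-- A nontrivial Weyl operator commuting with the stabilizer is not detected if it lies outside the
stabilizer or if the code is one-dimensional: it preserves the code, so a detecting constant `μ ≠ 0`
would be its only eigenvalue there, and comparing traces gives `μ = 0`. -/
theorem not_exists_inner_weyl_eq (hψ : ψ ≠ 0) (hc : IsPhase ψ a b c)
    (hQ : stabilizerCode ψ a b c ≠ ⊥)
    {a₀ b₀ : ι → K} (hcomm : ∀ g, b g ⬝ᵥ a₀ = b₀ ⬝ᵥ a g) (h₀ : a₀ ≠ 0 ∨ b₀ ≠ 0)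
    (hout : Module.finrank ℂ (stabilizerCode ψ a b c) = 1 ∨
      ∀ g, a₀ + a g ≠ 0 ∨ b₀ + b g ≠ 0) {N : ℂ} :
    ¬ ∃ μ : ℂ, (∀ u ∈ stabilizerCode ψ a b c, ∀ v ∈ stabilizerCode ψ a b c,
        inner ℂ u (toEuclideanLin (weyl ψ a₀ b₀) v) = μ * inner ℂ u v) ∧
      (Module.finrank ℂ (stabilizerCode ψ a b c) = 1 → μ = (weyl ψ a₀ b₀).trace / N) := by
  rintro ⟨μ, hμ, hone⟩
  have hsmul : ∀ v ∈ stabilizerCode ψ a b c, toEuclideanLin (weyl ψ a₀ b₀) v = μ • v := by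
    intro v hv
    have hmem := Submodule.sub_mem _ (weyl_mem_stabilizerCode hcomm hv)
      (Submodule.smul_mem _ μ hv)
    rw [← sub_eq_zero, ← inner_self_eq_zero (𝕜 := ℂ)]
    rw [inner_sub_right, hμ _ hmem v hv, inner_smul_right, sub_self]
  have hμ0 : μ ≠ 0 := by
    rintro rfl
    obtain ⟨v, hv, hv0⟩ := Submodule.exists_mem_ne_zero_of_ne_bot hQ
    have h := inner_toEuclideanLin_weyl ψ a₀ b₀ 1 v v
    rw [Matrix.mul_one, conjTranspose_weyl_mul_self, hsmul v hv, zero_smul, inner_zero_left,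
      Matrix.toLpLin_one, LinearMap.id_apply] at h
    exact hv0 (inner_self_eq_zero.1 h.symm)
  rcases hout with h1 | hout
  · exact hμ0 (by rw [hone h1, trace_weyl ψ hψ h₀, zero_div])
  · have hWP : weyl ψ a₀ b₀ * stabilizerProj ψ a b c = μ • stabilizerProj ψ a b c := by
      apply toEuclideanLin.injective
      refine LinearMap.ext fun v => ?_
      rw [Matrix.toLpLin_mul_same, LinearMap.comp_apply,
        hsmul _ ((isProj_stabilizerProj hc).map_mem v), map_smul, LinearMap.smul_apply]
    have htr := congrArg Matrix.trace hWP
    rw [Matrix.trace_smul, ← trace_toEuclideanLin (stabilizerProj ψ a b c),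
      (isProj_stabilizerProj hc).trace, stabilizerProj, Matrix.mul_smul, Matrix.trace_smul,
      Finset.mul_sum, Matrix.trace_sum, Finset.sum_eq_zero, smul_zero] at htr
    · refine smul_ne_zero hμ0 ?_ htr.symm
      rw [Nat.cast_ne_zero, Ne, Submodule.finrank_eq_zero]
      exact hQ
    · intro g _
      rw [Matrix.mul_smul, weyl_mul, Matrix.trace_smul, Matrix.trace_smul,
        trace_weyl ψ hψ (hout g), smul_zero, smul_zero]

end Detection

/-! ### Quadratic extensions of finite fields -/

section QuadraticExtension

open Matrix Finset Polynomial

variable {K L : Type*} [Field K] [Fintype K] [Field L] [Algebra K L]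

theorem pow_card_pow_card {K L : Type*} [Fintype K] [Field L] [Fintype L]
    (hL : Fintype.card L = Fintype.card K ^ 2) (z : L) :
    (z ^ Fintype.card K) ^ Fintype.card K = z := by
  rw [← pow_mul, ← sq, ← hL, FiniteField.pow_card]

theorem exists_pow_card_ne {K L : Type*} [Field K] [Fintype K] [Field L] [Fintype L]
    (hL : Fintype.card L = Fintype.card K ^ 2) :
    ∃ γ : L, γ ^ Fintype.card K ≠ γ := by
  classical
  by_contra! h
  have hK : 1 < Fintype.card K := Fintype.one_lt_card
  have hp := FiniteField.X_pow_card_sub_X_ne_zero L hK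
  have hle := Polynomial.card_roots' (X ^ Fintype.card K - X : L[X])
  rw [FiniteField.X_pow_card_sub_X_natDegree_eq L hK] at hle
  have hsub : (univ : Finset L) ⊆ (X ^ Fintype.card K - X : L[X]).roots.toFinset := by
    intro z _
    rw [Multiset.mem_toFinset, mem_roots hp, IsRoot.def, eval_sub, eval_pow, eval_X, h z, sub_self]
  have := (Finset.card_le_card hsub).trans ((Multiset.toFinset_card_le _).trans hle)
  rw [Finset.card_univ, hL] at this
  nlinarith

theorem algebraMap_pow_card (r : K) :
    algebraMap K L r ^ Fintype.card K = algebraMap K L r := by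
  rw [← map_pow, FiniteField.pow_card]

theorem add_pow_card (x y : L) :
    (x + y) ^ Fintype.card K = x ^ Fintype.card K + y ^ Fintype.card K :=
  map_add (FiniteField.frobeniusAlgHom K L) x y

theorem sum_pow_card {ι : Type*} (s : Finset ι) (f : ι → L) :
    (∑ i ∈ s, f i) ^ Fintype.card K = ∑ i ∈ s, f i ^ Fintype.card K :=
  map_sum (FiniteField.frobeniusAlgHom K L) f s

theorem prod_sub_algebraMap (z : L) :
    ∏ r : K, (z - algebraMap K L r) = z ^ Fintype.card K - z := by
  have hK : 1 < Fintype.card K := Fintype.one_lt_card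
  have hroots := FiniteField.roots_X_pow_card_sub_X K
  have h := prod_multiset_X_sub_C_of_monic_of_roots_card_eq
    (p := (X ^ Fintype.card K - X : K[X]))
    (monic_X_pow_sub (by rw [degree_X]; exact_mod_cast hK))
    (by rw [hroots, FiniteField.X_pow_card_sub_X_natDegree_eq K hK]; rfl)
  rw [hroots] at h
  have h2 := congrArg (Polynomial.aeval z) h
  change Polynomial.aeval z (∏ r : K, (X - C r)) = _ at h2
  simpa [map_prod] using h2

/-- For the points `b + γ δⱼ` of `t` parallel cosets of `K` in `L`, the derivative of the nodal
polynomial takes values in a fixed multiple of `K`. -/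
theorem exists_prod_erase_cosets [DecidableEq K] {t : ℕ} {δ : Fin t → K} (hδ : Function.Injective δ)
    (γ : L) (i : Fin t × K) :
    ∃ r : K, r ≠ 0 ∧ ∏ p ∈ univ.erase i, ((algebraMap K L i.2 + γ * algebraMap K L (δ i.1)) -
        (algebraMap K L p.2 + γ * algebraMap K L (δ p.1))) =
      (γ ^ Fintype.card K - γ) ^ (t - 1) * algebraMap K L r := by
  set θ := γ ^ Fintype.card K - γ with hθ
  set x : Fin t × K → L := fun p => algebraMap K L p.2 + γ * algebraMap K L (δ p.1) with hx
  have hcoset : ∀ j, ∃ r : K, r ≠ 0 ∧ ∏ b : K, (if (j, b) = i then 1 else x i - x (j, b)) =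
      (if j = i.1 then 1 else θ) * algebraMap K L r := by
    intro j
    by_cases hj : j = i.1
    · refine ⟨∏ b : K, if b = i.2 then 1 else i.2 - b, ?_, ?_⟩
      · refine Finset.prod_ne_zero_iff.2 fun b _ => ?_
        split_ifs with hb
        · exact one_ne_zero
        · exact sub_ne_zero.2 (Ne.symm hb)
      · rw [if_pos hj, one_mul, map_prod]
        refine Finset.prod_congr rfl fun b _ => ?_
        by_cases hb : b = i.2
        · rw [if_pos hb, if_pos (Prod.ext hj hb), map_one]
        · rw [if_neg hb, if_neg fun h => hb (congrArg Prod.snd h), map_sub, hx]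
          simp only [hj]
          ring
    · refine ⟨δ i.1 - δ j, sub_ne_zero.2 fun h => hj (hδ h).symm, ?_⟩
      rw [if_neg hj]
      have hprod := prod_sub_algebraMap (K := K)
        (algebraMap K L i.2 + γ * algebraMap K L (δ i.1 - δ j))
      rw [add_pow_card, mul_pow, algebraMap_pow_card, algebraMap_pow_card] at hprod
      trans ∏ r : K, (algebraMap K L i.2 + γ * algebraMap K L (δ i.1 - δ j) - algebraMap K L r)
      · refine Finset.prod_congr rfl fun b _ => ?_
        rw [if_neg fun h => hj (congrArg Prod.fst h), hx, map_sub]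
        ring
      · rw [hprod, hθ]
        ring
  choose r hr0 hr using hcoset
  refine ⟨∏ j, r j, Finset.prod_ne_zero_iff.2 fun j _ => hr0 j, ?_⟩
  have hθpow : ∏ j : Fin t, (if j = i.1 then 1 else θ) = θ ^ (t - 1) := by
    rw [← Finset.mul_prod_erase univ _ (mem_univ i.1), if_pos rfl, one_mul,
      Finset.prod_congr rfl fun j hj => if_neg (Finset.ne_of_mem_erase hj), Finset.prod_const,
      Finset.card_erase_of_mem (mem_univ _), Finset.card_univ, Fintype.card_fin]
  rw [← hθpow, map_prod, ← Finset.prod_mul_distrib, ← Finset.prod_congr rfl fun j _ => hr j,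
    ← Fintype.prod_prod_type' fun j b => if (j, b) = i then 1 else x i - x (j, b),
    ← Finset.mul_prod_erase univ _ (mem_univ i), if_pos rfl, one_mul]
  exact Finset.prod_congr rfl fun p hp => (if_neg (Finset.ne_of_mem_erase hp)).symm

variable [Fintype L]

/-- An element `γ` not fixed by Frobenius gives the `K`-basis `1, γ` of the quadratic extension. -/
theorem exists_coordinates (hL : Fintype.card L = Fintype.card K ^ 2) {γ : L}
    (hγ : γ ^ Fintype.card K ≠ γ) :
    ∃ e : L ≃+ K × K, ∀ z, z = algebraMap K L (e z).1 + γ * algebraMap K L (e z).2 := by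
  let f : K × K →+ L :=
    { toFun := fun p => algebraMap K L p.1 + γ * algebraMap K L p.2
      map_zero' := by simp
      map_add' := fun p p' => by simp only [Prod.fst_add, Prod.snd_add, map_add]; ring }
  have hinj : Function.Injective f := by
    refine (injective_iff_map_eq_zero f).2 fun p hp => ?_
    change algebraMap K L p.1 + γ * algebraMap K L p.2 = 0 at hp
    have hq : algebraMap K L p.1 + γ ^ Fintype.card K * algebraMap K L p.2 = 0 := by
      have h := congrArg (· ^ Fintype.card K) hp
      simpa only [add_pow_card, mul_pow, algebraMap_pow_card, zero_pow Fintype.card_ne_zero]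
        using h
    have h2 : (γ ^ Fintype.card K - γ) * algebraMap K L p.2 = 0 := by
      linear_combination hq - hp
    have h2' := (mul_eq_zero.1 h2).resolve_left (sub_ne_zero.2 hγ)
    rw [h2', mul_zero, add_zero] at hp
    exact Prod.ext ((map_eq_zero _).1 hp) ((map_eq_zero _).1 h2')
  have hbij : Function.Bijective f :=
    (Fintype.bijective_iff_injective_and_card f).2 ⟨hinj, by rw [Fintype.card_prod, hL, sq]⟩
  refine ⟨(AddEquiv.ofBijective f hbij).symm, fun z => ?_⟩
  exact ((AddEquiv.ofBijective f hbij).apply_symm_apply z).symm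

/-- Hermitian orthogonal vectors have symplectically orthogonal coordinate vectors: with
`θ = γ ^ q - γ`, the symplectic form of the coordinates is `θ⁻¹ (∑ zᵢ yᵢ ^ q - ∑ yᵢ zᵢ ^ q)`. -/
theorem dotProduct_eq_of_hermitian_eq_zero {ι : Type*} [Fintype ι]
    (hL : Fintype.card L = Fintype.card K ^ 2) {γ : L} (hγ : γ ^ Fintype.card K ≠ γ)
    {e : L ≃+ K × K}
    (he : ∀ z, z = algebraMap K L (e z).1 + γ * algebraMap K L (e z).2)
    {y z : ι → L} (h : ∑ i, y i * z i ^ Fintype.card K = 0) :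
    (fun i => (e (y i)).2) ⬝ᵥ (fun i => (e (z i)).1) =
      (fun i => (e (z i)).2) ⬝ᵥ (fun i => (e (y i)).1) := by
  have h' : ∑ i, z i * y i ^ Fintype.card K = 0 := by
    have h2 := congrArg (· ^ Fintype.card K) h
    simp only [sum_pow_card, mul_pow, pow_card_pow_card hL, zero_pow Fintype.card_ne_zero] at h2
    rw [← h2]
    exact Finset.sum_congr rfl fun i _ => mul_comm _ _
  have hpow : ∀ z, z ^ Fintype.card K =
      algebraMap K L (e z).1 + γ ^ Fintype.card K * algebraMap K L (e z).2 := by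
    intro z
    conv_lhs => rw [he z]
    rw [add_pow_card, mul_pow, algebraMap_pow_card, algebraMap_pow_card]
  apply (algebraMap K L).injective
  apply mul_left_cancel₀ (sub_ne_zero.2 hγ)
  have hterm : ∀ i, (γ ^ Fintype.card K - γ) * (algebraMap K L (e (y i)).2 *
      algebraMap K L (e (z i)).1 - algebraMap K L (e (z i)).2 * algebraMap K L (e (y i)).1) =
      z i * y i ^ Fintype.card K - y i * z i ^ Fintype.card K := by
    intro i
    rw [hpow (y i), hpow (z i)]
    linear_combination (algebraMap K L (e (z i)).1 + γ ^ Fintype.card K *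
      algebraMap K L (e (z i)).2) * he (y i) - (algebraMap K L (e (y i)).1 +
      γ ^ Fintype.card K * algebraMap K L (e (y i)).2) * he (z i)
  rw [← sub_eq_zero, ← mul_sub]
  simp only [dotProduct, map_sum, map_mul, ← Finset.sum_sub_distrib, Finset.mul_sum, hterm]
  rw [Finset.sum_sub_distrib, h, h', sub_zero]

/-- Points and column multipliers of a generalized Reed-Solomon code of length `t q`, `t ≤ q`, whose
multipliers have norms proportional to the Lagrange weights of the points. -/
theorem exists_points_and_multipliers [DecidableEq K]
    (hL : Fintype.card L = Fintype.card K ^ 2) {t : ℕ}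
    (ht : t ≤ Fintype.card K) {ι : Type*} [Fintype ι] [DecidableEq ι]
    (hι : Fintype.card ι = t * Fintype.card K) :
    ∃ (x v : ι → L) (η : L), Function.Injective x ∧ (∀ i, v i ≠ 0) ∧
      ∀ i, v i ^ (Fintype.card K + 1) = η / ∏ j ∈ univ.erase i, (x i - x j) := by
  obtain ⟨γ, hγ⟩ := exists_pow_card_ne hL
  obtain ⟨δ⟩ : Nonempty (Fin t ↪ K) :=
    Function.Embedding.nonempty_of_card_le (by rwa [Fintype.card_fin])
  let σ : ι ≃ Fin t × K := Fintype.equivOfCardEq (by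
    rw [hι, Fintype.card_prod, Fintype.card_fin])
  set y : Fin t × K → L := fun p => algebraMap K L p.2 + γ * algebraMap K L (δ p.1) with hy
  choose r hr0 hr using exists_prod_erase_cosets δ.injective γ
  have hθ := pow_ne_zero (t - 1) (sub_ne_zero.2 hγ)
  have hyinj : Function.Injective y := by
    intro p p' h
    by_contra hne
    have h0 : ∏ p' ∈ univ.erase p, (y p - y p') ≠ 0 := by
      rw [hr]
      exact mul_ne_zero hθ ((_root_.map_ne_zero _).2 (hr0 p))
    refine h0 (Finset.prod_eq_zero (Finset.mem_erase.2 ⟨Ne.symm hne, mem_univ p'⟩) ?_)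
    rw [h, sub_self]
  have hnorm : ∀ s : K, ∃ v : L, v ^ (Fintype.card K + 1) = algebraMap K L s := by
    intro s
    obtain ⟨v, hv⟩ := FiniteField.norm_surjective K L s
    refine ⟨v, ?_⟩
    rw [← hv, FiniteField.algebraMap_norm_eq_pow, Nat.card_eq_fintype_card,
      Nat.card_eq_fintype_card, hL]
    congr 1
    have hK : 1 < Fintype.card K := Fintype.one_lt_card
    rw [← one_pow 2, Nat.sq_sub_sq, one_pow, Nat.mul_div_cancel _ (Nat.sub_pos_of_lt hK)]
  choose N hN using hnorm
  refine ⟨fun i => y (σ i), fun i => N (r (σ i))⁻¹, (γ ^ Fintype.card K - γ) ^ (t - 1),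
    hyinj.comp σ.injective, fun i h0 => ?_, fun i => ?_⟩
  · have h := hN (r (σ i))⁻¹
    have h0' : N (r (σ i))⁻¹ = 0 := h0
    rw [h0', zero_pow (Nat.succ_ne_zero _), eq_comm, map_eq_zero, inv_eq_zero] at h
    exact hr0 _ h
  · have hprod : ∏ j ∈ univ.erase i, (y (σ i) - y (σ j)) =
        ∏ p ∈ univ.erase (σ i), (y (σ i) - y p) :=
      Finset.prod_equiv σ (by simp) (by simp)
    rw [hprod, hr, hN, map_inv₀, div_mul_cancel_left₀ hθ]

end QuadraticExtension

/-! ### Generalized Reed-Solomon codes -/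

section ReedSolomon

open Finset Polynomial

variable {L : Type*} [Field L] {ι : Type*}

/-- The encoder `f ↦ (vᵢ f(xᵢ))ᵢ` of the generalized Reed-Solomon code of dimension `k`. -/
noncomputable def grsEncode (x v : ι → L) (k : ℕ) : degreeLT L k →+ (ι → L) where
  toFun f i := v i * (f : L[X]).eval (x i)
  map_zero' := by ext; simp
  map_add' f g := by ext; simp [mul_add]

theorem grsEncode_apply (x v : ι → L) (k : ℕ) (f : degreeLT L k) (i : ι) :
    grsEncode x v k f i = v i * (f : L[X]).eval (x i) := rfl

variable {x v : ι → L} {k : ℕ}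

theorem eq_zero_of_grsEncode_eq_zero (hx : Function.Injective x) (hv : ∀ i, v i ≠ 0)
    {T : Finset ι} (hT : k ≤ T.card) {f : degreeLT L k} (hf : ∀ i ∈ T, grsEncode x v k f i = 0) :
    f = 0 := by
  apply Subtype.ext
  refine eq_zero_of_degree_lt_of_eval_index_eq_zero T hx.injOn ?_ fun i hi => ?_
  · exact (mem_degreeLT.1 f.2).trans_le (by exact_mod_cast hT)
  · exact (mul_eq_zero.1 (hf i hi)).resolve_left (hv i)

variable [DecidableEq ι]

theorem exists_grsEncode_eq (hx : Function.Injective x) (hv : ∀ i, v i ≠ 0)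
    {S : Finset ι} (hS : S.card ≤ k) (τ : ι → L) :
    ∃ f, ∀ i ∈ S, grsEncode x v k f i = τ i := by
  refine ⟨⟨Lagrange.interpolate S x fun i => (v i)⁻¹ * τ i, mem_degreeLT.2 ?_⟩, fun i hi => ?_⟩
  · exact (Lagrange.degree_interpolate_lt _ hx.injOn).trans_le (by exact_mod_cast hS)
  · rw [grsEncode_apply, Lagrange.eval_interpolate_at_node _ hx.injOn hi,
      mul_inv_cancel_left₀ (hv i)]

/-- The dual of a generalized Reed-Solomon code of dimension `k` has a word with any prescribed
support of size `k + 1`, given by the Lagrange weights of that support. -/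
theorem exists_dual_word [Fintype ι] (hx : Function.Injective x) (hv : ∀ i, v i ≠ 0)
    {S : Finset ι} (hS : S.card = k + 1) :
    ∃ u : ι → L, (∀ i ∈ S, u i ≠ 0) ∧ (∀ i, i ∉ S → u i = 0) ∧
      ∀ f, ∑ i, grsEncode x v k f i * u i = 0 := by
  refine ⟨fun i => if i ∈ S then (v i * ∏ j ∈ S.erase i, (x i - x j))⁻¹ else 0,
    fun i hi => ?_, fun i hi => if_neg hi, fun f => ?_⟩
  · simp only [if_pos hi]
    refine inv_ne_zero (mul_ne_zero (hv i) (Finset.prod_ne_zero_iff.2 fun j hj => ?_))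
    exact sub_ne_zero.2 (hx.ne (Finset.ne_of_mem_erase hj).symm)
  · have hdeg : (f : L[X]).degree < k := mem_degreeLT.1 f.2
    have h := Lagrange.coeff_eq_sum (s := S) (v := x) hx.injOn
      (P := (f : L[X])) (hdeg.trans (by rw [hS]; exact_mod_cast Nat.lt_succ_self k))
    rw [hS, Nat.add_sub_cancel, coeff_eq_zero_of_degree_lt hdeg] at h
    refine Eq.trans ?_ h.symm
    simp only [mul_ite, mul_zero, Finset.sum_ite_mem, Finset.univ_inter]
    refine Finset.sum_congr rfl fun i _ => ?_
    rw [grsEncode_apply, mul_inv, div_eq_mul_inv]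
    have := hv i
    field_simp

/-- If the norms of the multipliers are proportional to the Lagrange weights, the code is Hermitian
self-orthogonal: the products `f · g ^ q` have degree at most `n - 2`, so their divided difference
over all `n` points vanishes. -/
theorem grsEncode_hermitian_eq_zero [Fintype ι] {q : ℕ} {η : L} (hx : Function.Injective x)
    (hη : ∀ i, v i ^ (q + 1) = η / ∏ j ∈ univ.erase i, (x i - x j))
    (hn : (k - 1) * (q + 1) + 2 ≤ Fintype.card ι) (f g : degreeLT L k) :
    ∑ i, grsEncode x v k f i * grsEncode x v k g i ^ q = 0 := by
  have hdeg : ∀ p : degreeLT L k, (p : L[X]).natDegree ≤ k - 1 := by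
    intro p
    rcases eq_or_ne (p : L[X]) 0 with h0 | h0
    · rw [h0, natDegree_zero]
      exact Nat.zero_le _
    · exact Nat.le_sub_one_of_lt ((natDegree_lt_iff_degree_lt h0).2 (mem_degreeLT.1 p.2))
  have hdeg' : ((f : L[X]) * (g : L[X]) ^ q).degree < ((Fintype.card ι - 1 : ℕ) : WithBot ℕ) := by
    refine degree_le_natDegree.trans_lt ?_
    have h3 : ((f : L[X]) * (g : L[X]) ^ q).natDegree ≤ (k - 1) + q * (k - 1) :=
      natDegree_mul_le.trans (add_le_add (hdeg f)
        (natDegree_pow_le.trans (Nat.mul_le_mul_left q (hdeg g))))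
    have h4 : (k - 1) + q * (k - 1) = (k - 1) * (q + 1) := by ring
    exact_mod_cast (by omega : ((f : L[X]) * (g : L[X]) ^ q).natDegree < Fintype.card ι - 1)
  have h := Lagrange.coeff_eq_sum (s := univ) (v := x) hx.injOn
      (P := (f : L[X]) * (g : L[X]) ^ q) (hdeg'.trans_le (by
        rw [Finset.card_univ]; exact_mod_cast Nat.sub_le _ _))
  rw [Finset.card_univ, coeff_eq_zero_of_degree_lt hdeg'] at h
  rw [← mul_zero η, h, Finset.mul_sum]
  refine Finset.sum_congr rfl fun i _ => ?_
  rw [grsEncode_apply, grsEncode_apply, mul_pow, mul_mul_mul_comm, ← pow_succ', hη, eval_mul,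
    eval_pow]
  ring

end ReedSolomon

/-! ### The quantum MDS codes -/

section Construction

open Matrix Finset Polynomial

/-- The stabilizer code of a Hermitian self-orthogonal generalized Reed-Solomon code of dimension
`k` detects all errors on `k` factors and misses some error on `k + 1` factors. -/
theorem exists_quantum_mds_code {K L : Type*} [Field K] [Fintype K] [DecidableEq K] [Field L]
    [Fintype L] [Algebra K L] (hL : Fintype.card L = Fintype.card K ^ 2) {n t k : ℕ}
    (hn : n = t * Fintype.card K) (ht : t ≤ Fintype.card K)
    (hkn : (k - 1) * (Fintype.card K + 1) + 2 ≤ n) (h2k : 2 * k ≤ n) (hkn' : k + 1 ≤ n) :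
    ∃ Q : Submodule ℂ (EuclideanSpace ℂ (Fin n → K)),
      Module.finrank ℂ Q = Fintype.card K ^ (n - 2 * k) ∧
      (∀ (S : Finset (Fin n)), S.card ≤ k →
        ∀ E : Matrix (Fin n → K) (Fin n → K) ℂ, ActsOn S E →
        ∀ u ∈ Q, ∀ v ∈ Q, inner ℂ u (toEuclideanLin E v) =
          E.trace / (Fintype.card K : ℂ) ^ n * inner ℂ u v) ∧
      ∃ (S : Finset (Fin n)) (E : Matrix (Fin n → K) (Fin n → K) ℂ),
        S.card = k + 1 ∧ ActsOn S E ∧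
        ¬ ∃ c : ℂ, (∀ u ∈ Q, ∀ v ∈ Q,
            inner ℂ u (toEuclideanLin E v) = c * inner ℂ u v) ∧
          (Module.finrank ℂ Q = 1 → c = E.trace / (Fintype.card K : ℂ) ^ n) := by
  obtain ⟨γ, hγ⟩ := exists_pow_card_ne hL
  obtain ⟨e, he⟩ := exists_coordinates hL hγ
  obtain ⟨x, v, η, hx, hv, hη⟩ := exists_points_and_multipliers (ι := Fin n) hL ht
    (by rw [Fintype.card_fin, hn])
  obtain ⟨ψ, hψ⟩ : ∃ ψ : AddChar K ℂ, ψ 1 ≠ 1 := AddChar.exists_apply_ne_zero.2 one_ne_zero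
  replace hψ : ψ ≠ 0 := AddChar.ne_zero_iff.2 ⟨1, hψ⟩
  have hfin : Finite (degreeLT L k) := Finite.of_equiv _ (degreeLTEquiv L k).symm.toEquiv
  have := Fintype.ofFinite (degreeLT L k)
  have hcardG : Fintype.card (degreeLT L k) = Fintype.card K ^ (2 * k) := by
    rw [Fintype.card_congr (degreeLTEquiv L k).toEquiv, Fintype.card_fun, hL, Fintype.card_fin,
      pow_mul]
  let fst : (Fin n → L) →+ (Fin n → K) :=
    ((AddMonoidHom.fst K K).comp e.toAddMonoidHom).compLeft (Fin n)
  let snd : (Fin n → L) →+ (Fin n → K) :=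
    ((AddMonoidHom.snd K K).comp e.toAddMonoidHom).compLeft (Fin n)
  have hfst_snd : ∀ z : Fin n → L, fst z = 0 → snd z = 0 → z = 0 := by
    intro z h1 h2
    funext i
    rw [Pi.zero_apply, he (z i), show (e (z i)).1 = 0 from congrFun h1 i,
      show (e (z i)).2 = 0 from congrFun h2 i, map_zero, mul_zero, add_zero]
  let c := grsEncode x v k
  let a := fst.comp c
  let b := snd.comp c
  have hcinj : ∀ g, c g = 0 → g = 0 := fun g hg =>
    eq_zero_of_grsEncode_eq_zero hx hv (T := univ)
      (by rw [Finset.card_univ, Fintype.card_fin]; omega) fun i _ => congrFun hg i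
  have hcomm : ∀ g h, b g ⬝ᵥ a h = b h ⬝ᵥ a g := fun g h =>
    dotProduct_eq_of_hermitian_eq_zero hL hγ he
      (grsEncode_hermitian_eq_zero hx hη (by rwa [Fintype.card_fin]) g h)
  obtain ⟨lam, hlam⟩ := exists_isPhase (ψ := ψ) hcomm
  have hrank : Module.finrank ℂ (stabilizerCode ψ a b lam) = Fintype.card K ^ (n - 2 * k) := by
    have h := finrank_stabilizerCode_mul_card hψ
      (fun g h1 h2 => hcinj g (hfst_snd _ h1 h2)) hlam
    refine Nat.eq_of_mul_eq_mul_right (pow_pos (Fintype.card_pos (α := K)) (2 * k)) ?_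
    rw [← pow_add, Nat.sub_add_cancel h2k, ← hcardG, h, Fintype.card_fin]
  refine ⟨stabilizerCode ψ a b lam, hrank, ?_, ?_⟩
  · intro S hS E hE u hu w hw
    have h := inner_toEuclideanLin_of_mem_stabilizerCode hψ hlam (S := S) ?_ hE hu hw
    · rwa [Fintype.card_fin] at h
    · intro α β
      obtain ⟨f, hf⟩ := exists_grsEncode_eq hx hv hS fun i => e.symm (α i, β i)
      refine ⟨f, fun i hi => ⟨?_, ?_⟩⟩
      · change (e (grsEncode x v k f i)).1 = α i
        rw [hf i hi, e.apply_symm_apply]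
      · change (e (grsEncode x v k f i)).2 = β i
        rw [hf i hi, e.apply_symm_apply]
  · obtain ⟨S, -, hS⟩ := Finset.exists_subset_card_eq
      (s := (univ : Finset (Fin n))) (n := k + 1) (by rwa [Finset.card_univ, Fintype.card_fin])
    obtain ⟨u, huS, hu0, hu⟩ := exists_dual_word hx hv hS
    -- the Frobenius power turns the Euclidean dual word `u` into a Hermitian dual word
    set w : Fin n → L := fun i => u i ^ Fintype.card K with hw
    have hw0 : ∀ i, i ∉ S → w i = 0 := fun i hi => by
      rw [hw]
      simp only [hu0 i hi, zero_pow Fintype.card_ne_zero]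
    have hwne : w ≠ 0 := by
      obtain ⟨i, hi⟩ := Finset.card_pos.1 (show 0 < S.card by omega)
      exact fun h => pow_ne_zero _ (huS i hi) (congrFun h i)
    have hA := weyl_actsOn (ψ := ψ) (S := S) (a₀ := fst w) (b₀ := snd w)
      (fun i hi => by change (e (w i)).1 = 0; rw [hw0 i hi, map_zero]; rfl)
      (fun i hi => by change (e (w i)).2 = 0; rw [hw0 i hi, map_zero]; rfl)
    refine ⟨S, weyl ψ (fst w) (snd w), hS, hA, not_exists_inner_weyl_eq hψ hlam ?_ ?_ ?_ ?_⟩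
    · intro hbot
      rw [hbot, finrank_bot] at hrank
      exact (pow_pos (Fintype.card_pos (α := K)) _).ne hrank
    · intro g
      refine dotProduct_eq_of_hermitian_eq_zero hL hγ he ?_
      rw [← hu g]
      refine Finset.sum_congr rfl fun i _ => ?_
      rw [hw, pow_card_pow_card hL]
    · by_contra! h
      exact hwne (hfst_snd w h.1 h.2)
    · rcases h2k.eq_or_lt with h | h
      · left
        rw [hrank, h, Nat.sub_self, pow_zero]
      · right
        intro g
        by_contra! h0
        have hwg : w + c g = 0 := hfst_snd _ ((map_add fst _ _).trans h0.1)
          ((map_add snd _ _).trans h0.2)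
        -- a code word supported on `S` has at least `n - (k + 1) ≥ k` zeros
        have hg : g = 0 := by
          refine eq_zero_of_grsEncode_eq_zero hx hv (T := Sᶜ) ?_ fun i hi => ?_
          · rw [Finset.card_compl, hS, Fintype.card_fin]
            omega
          · have := congrFun hwg i
            rwa [Pi.add_apply, hw0 i (Finset.mem_compl.1 hi), zero_add] at this
        rw [hg, map_zero, add_zero] at hwg
        exact hwne hwg

end Construction

theorem theorem1 (q t d : ℕ) (hq : IsPrimePow q) (ht : 1 ≤ t) (htq : t ≤ q)
    (hd : 2 ≤ d) (hd' : d ≤ (t * q + q - 1) / (q + 1) + 1) :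
    ∃ k : ℕ, (k : ℤ) = (t : ℤ) * (q : ℤ) - 2 * (d : ℤ) + 2 ∧
      ∃ Q : Submodule ℂ (QuditSpace q (t * q)), IsQuantumMDSCode Q k d := by
  have hq2 : 2 ≤ q := hq.two_le
  obtain ⟨r, rfl⟩ : ∃ r, d = r + 1 := ⟨d - 1, by omega⟩
  have hn2 : 2 ≤ t * q := by nlinarith
  have hr : r * (q + 1) ≤ t * q + q - 1 :=
    (Nat.le_div_iff_mul_le (Nat.succ_pos q)).1 (Nat.le_of_add_le_add_right hd')
  have hr1 : (r - 1) * (q + 1) + 2 ≤ t * q := by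
    obtain ⟨s, rfl⟩ : ∃ s, r = s + 1 := ⟨r - 1, by omega⟩
    rw [Nat.add_sub_cancel]
    rw [add_mul] at hr
    omega
  have h2r : 2 * r ≤ t * q := by
    by_contra! h
    have h1 : r * (q + 1) + 1 ≤ t * q + q := by omega
    nlinarith
  -- the alphabet `Fin q` itself is made into a field
  obtain ⟨instField⟩ : Nonempty (Field (Fin q)) :=
    Fintype.nonempty_field_iff.2 (by rwa [Fintype.card_fin])
  obtain ⟨p, hp⟩ := CharP.exists (Fin q)
  have hpp : Fact p.Prime := ⟨CharP.char_is_prime (Fin q) p⟩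
  have := Fintype.ofFinite (FiniteField.Extension (Fin q) p 2)
  obtain ⟨Q, hrank, hdet, S, E, hS, hE, hnot⟩ :=
    exists_quantum_mds_code (K := Fin q) (L := FiniteField.Extension (Fin q) p 2)
      (by rw [← Nat.card_eq_fintype_card, FiniteField.natCard_extension,
        Nat.card_eq_fintype_card])
      (n := t * q) (t := t) (k := r) (by rw [Fintype.card_fin])
      (by rwa [Fintype.card_fin]) (by rwa [Fintype.card_fin]) h2r (by omega)
  rw [Fintype.card_fin] at hrank
  simp only [Fintype.card_fin] at hdet hnot
  refine ⟨t * q - 2 * r, by push_cast [Nat.cast_sub h2r]; ring, Q, ⟨hrank, ?_, ?_⟩, ?_⟩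
  · intro S hS E hE
    exact ⟨_, hdet S (by omega) E (QuditOp.supportedOn_iff_actsOn.1 hE), fun _ => rfl⟩
  · intro m hm
    by_contra! hlt
    exact hnot (hm S (by omega) E (QuditOp.supportedOn_iff_actsOn.2 hE))
  · push_cast [Nat.cast_sub h2r]
    ring
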